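/- All rings are associative with identity, not necessarily commutative. For a ring $S$ let $\mathrm{nil}(S)$ be its set of nilpotent elements and $P(S)$ its prime radical (the intersection of all prime two-sided ideals); $S$ is \emph{2-primal} if $P(S)=\mathrm{nil}(S)$. The \emph{nilpotent graph} $\Gamma_N(S)$ has as vertices the non-zero elements $a\in S$ such that $ab\in\mathrm{nil}(S)$ for some non-zero $b\in S$, and two distinct vertices $a,b$ are adjacent iff $ab\in\mathrm{nil}(S)$. The \emph{girth} $gr(\Gamma)$ of a graph is the length of a shortest cycle, and $\infty$ if there is no cycle. Let $A=\sigma(R)\langle x_1,\dots,x_n\rangle$ be a skew PBW extension of $R$. That is: $R$ is a subring of $A$ with the same identity; $A$ is a free left $R$-module with basis the monomials $x^\alpha=x_1^{\alpha_1}\cdots x_n^{\alpha_n}$, $\alpha\in\mathbb{N}^n$; for every $i$ and every non-zero $r\in R$ there is a non-zero $c_{i,r}\in R$ with $x_ir-c_{i,r}x_i\in R$; and for all $i,j$ there is a non-zero $d_{i,j}\in R$ with $x_jx_i-d_{i,j}x_ix_j\in R+Rx_1+\cdots+Rx_n$. Let $\sigma_i$ and $\delta_i$ be the (uniquely determined)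 injective endomorphism and $\sigma_i$-derivation of $R$ with $x_ir=\sigma_i(r)x_i+\delta_i(r)$ for all $r\in R$, and put $\sigma^\alpha=\sigma_1^{\alpha_1}\circ\cdots\circ\sigma_n^{\alpha_n}$ and $\delta^\alpha=\delta_1^{\alpha_1}\circ\cdots\circ\delta_n^{\alpha_n}$. Suppose that $R$ is \emph{$(\Sigma,\Delta)$-compatible}: for all $a,b\in R$ and $\alpha\in\mathbb{N}^n$, $a\sigma^\alpha(b)=0$ if and only if $ab=0$, and $ab=0$ implies $a\delta^\alpha(b)=0$. \textbf{Theorem.} If, in addition, $R$ is 2-primal, then $$gr(\Gamma_N(R))\ \ge\ gr(\Gamma_N(\sigma(R)\langle x_1,\dots,x_n\rangle)).$$ Moreover, if $\Gamma_N(R)$ contains a cycle, then $$gr(\Gamma_N(R))=gr(\Gamma_N(\sigma(R)\langle x_1,\dots,x_n\rangle)).$$ -/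

import Mathlib

/-- A two-sided ideal `P` of a (not necessarily commutative) ring is prime if it is proper and
`a S b ⊆ P` implies `a ∈ P` or `b ∈ P`. -/
structure IsPrimeTwoSided {S : Type*} [Ring S] (P : TwoSidedIdeal S) : Prop where
  ne_top : P ≠ ⊤
  mem_or_mem : ∀ a b : S, (∀ r : S, a * r * b ∈ P) → a ∈ P ∨ b ∈ P

/-- The prime radical: the intersection of all prime (two-sided) ideals. -/
def primeRadical (S : Type*) [Ring S] : TwoSidedIdeal S :=
  sInf {P : TwoSidedIdeal S | IsPrimeTwoSided P}

/-- A ring is 2-primal if its prime radical is the set of its nilpotent elements. -/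
def IsTwoPrimal (S : Type*) [Ring S] : Prop :=
  (primeRadical S : Set S) = {a : S | IsNilpotent a}

theorem isNilpotent_mul_swap {S : Type*} [Ring S] {a b : S} (h : IsNilpotent (a * b)) :
    IsNilpotent (b * a) := by
  obtain ⟨k, hk⟩ := h
  refine ⟨k + 1, ?_⟩
  have key : ∀ m : ℕ, (b * a) ^ (m + 1) = b * (a * b) ^ m * a := by
    intro m
    induction m with
    | zero => simp
    | succ m ih => rw [pow_succ, ih, pow_succ (a * b)]; simp only [mul_assoc]
  rw [key, hk, mul_zero, zero_mul]

/-- The set `Z_N(S)* = Z_N(S) \ {0}`, where `Z_N(S)` consists of all `a` such that `ab` is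
nilpotent for some non-zero `b`. -/
def nilZeroDivisors (S : Type*) [Ring S] : Set S :=
  {a : S | a ≠ 0 ∧ ∃ b : S, b ≠ 0 ∧ IsNilpotent (a * b)}

/-- The nilpotent graph `Γ_N(S)`: distinct vertices `a`, `b` are adjacent iff `ab` is nilpotent. -/
def nilpotentGraph (S : Type*) [Ring S] : SimpleGraph (nilZeroDivisors S) where
  Adj a b := a ≠ b ∧ IsNilpotent ((a : S) * (b : S))
  symm := ⟨fun _ _ h => ⟨h.1.symm, isNilpotent_mul_swap h.2⟩⟩
  loopless := ⟨fun _ h => h.1 rfl⟩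

/-- The standard monomial `x₁^α₁ ⋯ xₙ^αₙ` (in this order). -/
def stdMonomial {A : Type*} [Ring A] {n : ℕ} (x : Fin n → A) (α : Fin n → ℕ) : A :=
  (List.ofFn fun i => x i ^ α i).prod

/-- `A` is a skew PBW extension `σ(R)⟨x₁, …, xₙ⟩` of its subring `R`. -/
structure IsSkewPBWExtension {A : Type*} [Ring A] (R : Subring A) {n : ℕ} (x : Fin n → A) :
    Prop where
  linearIndependent : LinearIndependent R (stdMonomial x)
  span_eq_top : Submodule.span R (Set.range (stdMonomial x)) = ⊤
  exists_coeff : ∀ (i : Fin n) (r : R), r ≠ 0 →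
    ∃ c : R, c ≠ 0 ∧ x i * (r : A) - (c : A) * x i ∈ R
  exists_comm : ∀ i j : Fin n, ∃ d : R, d ≠ 0 ∧ ∃ (r₀ : R) (r : Fin n → R),
    x j * x i - (d : A) * x i * x j = (r₀ : A) + ∑ k, (r k : A) * x k

namespace IsSkewPBWExtension

variable {A : Type*} [Ring A] {R : Subring A} {n : ℕ} {x : Fin n → A}

theorem stdMonomial_zero (x : Fin n → A) : stdMonomial x 0 = 1 := by
  simp [stdMonomial]

theorem stdMonomial_single (x : Fin n → A) (i : Fin n) : stdMonomial x (Pi.single i 1) = x i := by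
  unfold stdMonomial
  induction n with
  | zero => exact i.elim0
  | succ n ih =>
    rw [List.ofFn_succ, List.prod_cons]
    refine Fin.cases ?_ (fun j => ?_) i
    · have : (fun j : Fin n => x j.succ ^ (Pi.single 0 1 : Fin (n + 1) → ℕ) j.succ)
          = fun _ => 1 := by
        funext j
        simp
      rw [this]
      simp
    · have : (fun k : Fin n => x k.succ ^ (Pi.single j.succ 1 : Fin (n + 1) → ℕ) k.succ)
          = fun k : Fin n => x k.succ ^ (Pi.single j 1 : Fin n → ℕ) k := by
        funext k
        simp [Pi.single_apply]
      rw [this, ih (fun k => x k.succ) j]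
      simp [Fin.succ_ne_zero, eq_comm]

/-- The basis of standard monomials of the left `R`-module `A`. -/
noncomputable def basis (h : IsSkewPBWExtension R x) : Module.Basis (Fin n → ℕ) R A :=
  Module.Basis.mk h.linearIndependent h.span_eq_top.ge

/-- The coefficient of `xᵢ` in `xᵢ r`. -/
noncomputable def sigmaFun (h : IsSkewPBWExtension R x) (i : Fin n) (r : R) : R :=
  h.basis.repr (x i * (r : A)) (Pi.single i 1)

/-- The constant coefficient of `xᵢ r`. -/
noncomputable def deltaFun (h : IsSkewPBWExtension R x) (i : Fin n) (r : R) : R :=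
  h.basis.repr (x i * (r : A)) 0

theorem repr_linear (h : IsSkewPBWExtension R x) (i : Fin n) (c d : R) :
    h.basis.repr ((c : A) * x i + (d : A)) =
      Finsupp.single (Pi.single i 1) c + Finsupp.single 0 d := by
  have h1 : (c : A) * x i + (d : A) =
      c • h.basis (Pi.single i 1) + d • h.basis (0 : Fin n → ℕ) := by
    simp [basis, stdMonomial_zero, stdMonomial_single, Subring.smul_def]
  rw [h1, map_add, map_smul, map_smul, Module.Basis.repr_self, Module.Basis.repr_self]
  simp

theorem eq_of_mul_eq (h : IsSkewPBWExtension R x) {i : Fin n} {r c d : R}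
    (e : x i * (r : A) = (c : A) * x i + (d : A)) :
    h.sigmaFun i r = c ∧ h.deltaFun i r = d := by
  have hne : (Pi.single i 1 : Fin n → ℕ) ≠ 0 := by simp
  unfold sigmaFun deltaFun
  rw [e, repr_linear]
  constructor <;> simp [hne, hne.symm]

theorem mul_eq_fun (h : IsSkewPBWExtension R x) (i : Fin n) (r : R) :
    x i * (r : A) = (h.sigmaFun i r : A) * x i + (h.deltaFun i r : A) := by
  have : ∃ c d : R, x i * (r : A) = (c : A) * x i + (d : A) := by
    by_cases hr : r = 0
    · exact ⟨0, 0, by simp [hr]⟩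
    · obtain ⟨c, -, hc⟩ := h.exists_coeff i r hr
      exact ⟨c, ⟨_, hc⟩, by simp⟩
  obtain ⟨c, d, e⟩ := this
  obtain ⟨h1, h2⟩ := h.eq_of_mul_eq e
  rw [h1, h2, e]

/-- The endomorphism `σᵢ` of `R` determined by `xᵢ r = σᵢ(r) xᵢ + δᵢ(r)`. -/
noncomputable def sigma (h : IsSkewPBWExtension R x) (i : Fin n) : R →+* R where
  toFun := h.sigmaFun i
  map_one' := (h.eq_of_mul_eq (i := i) (r := 1) (c := 1) (d := 0) (by simp)).1
  map_zero' := (h.eq_of_mul_eq (i := i) (r := 0) (c := 0) (d := 0) (by simp)).1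
  map_add' r s := (h.eq_of_mul_eq (d := h.deltaFun i r + h.deltaFun i s) (by
    push_cast
    rw [mul_add, h.mul_eq_fun i r, h.mul_eq_fun i s, add_mul]; abel)).1
  map_mul' r s := (h.eq_of_mul_eq
    (d := h.sigmaFun i r * h.deltaFun i s + h.deltaFun i r * s) (by
    push_cast
    rw [← mul_assoc, h.mul_eq_fun i r, add_mul, mul_assoc, h.mul_eq_fun i s, mul_add]
    simp only [mul_assoc, add_assoc])).1

/-- The `σᵢ`-derivation `δᵢ` of `R` determined by `xᵢ r = σᵢ(r) xᵢ + δᵢ(r)`. -/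
noncomputable def delta (h : IsSkewPBWExtension R x) (i : Fin n) : R →+ R where
  toFun := h.deltaFun i
  map_zero' := (h.eq_of_mul_eq (i := i) (r := 0) (c := 0) (d := 0) (by simp)).2
  map_add' r s := (h.eq_of_mul_eq (c := h.sigmaFun i r + h.sigmaFun i s) (by
    push_cast
    rw [mul_add, h.mul_eq_fun i r, h.mul_eq_fun i s, add_mul]; abel)).2

theorem mul_eq (h : IsSkewPBWExtension R x) (i : Fin n) (r : R) :
    x i * (r : A) = (h.sigma i r : A) * x i + (h.delta i r : A) :=
  h.mul_eq_fun i r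

theorem delta_mul (h : IsSkewPBWExtension R x) (i : Fin n) (r s : R) :
    h.delta i (r * s) = h.sigma i r * h.delta i s + h.delta i r * s :=
  (h.eq_of_mul_eq (c := h.sigma i r * h.sigma i s) (by
    push_cast
    rw [← mul_assoc, h.mul_eq i r, add_mul, mul_assoc, h.mul_eq i s, mul_add]
    simp only [mul_assoc, add_assoc])).2

theorem sigma_injective (h : IsSkewPBWExtension R x) (i : Fin n) :
    Function.Injective (h.sigma i) := by
  rw [injective_iff_map_eq_zero]
  intro r hr
  by_contra hne
  obtain ⟨c, hc, hm⟩ := h.exists_coeff i r hne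
  have e : h.sigma i r = c :=
    (h.eq_of_mul_eq (i := i) (r := r) (c := c) (d := ⟨_, hm⟩) (by simp)).1
  exact hc (e.symm.trans hr)

end IsSkewPBWExtension

/-- The composition `f₁^α₁ ∘ ⋯ ∘ fₙ^αₙ`. -/
def iterComp {S : Type*} {n : ℕ} (f : Fin n → S → S) (α : Fin n → ℕ) : S → S :=
  (List.ofFn fun i => (f i)^[α i]).foldr (fun g k => g ∘ k) id

/-- `S` is `Σ`-compatible: `a σ^α(b) = 0 ↔ a b = 0`. -/
def IsSigmaCompatible {S : Type*} [Ring S] {n : ℕ} (σ : Fin n → S →+* S) : Prop :=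
  ∀ (a b : S) (α : Fin n → ℕ), a * iterComp (fun i => ⇑(σ i)) α b = 0 ↔ a * b = 0

/-- `S` is `Δ`-compatible: `a b = 0 → a δ^β(b) = 0`. -/
def IsDeltaCompatible {S : Type*} [Ring S] {n : ℕ} (δ : Fin n → S →+ S) : Prop :=
  ∀ (a b : S) (β : Fin n → ℕ), a * b = 0 → a * iterComp (fun i => ⇑(δ i)) β b = 0

/-! The inclusion of `R` in `A` embeds one graph in the other, which gives the inequality. For
equality, suppose that `R` has a cycle but no triangle. Then `R` is reduced: a non-zero nilpotent
would be joined to every other vertex, because in a 2-primal ring the nilpotents form an ideal, and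
any edge avoiding it would complete a triangle. In a reduced ring any cycle can be shortened to
length at most 4, so it remains to exclude triangles in `A`. This is done with leading coefficients
(`IsLeadingExponent.mul_eq_zero`). Up to lower total degree, `x^α r x^β` is `s x^(α+β)`, where `a s
= 0` forces `a r = 0`; hence `f g = 0` forces the product of the leading coefficients to vanish. So
`A` is reduced, and a triangle in `A` yields one in `R`. -/

/-! ### Short cycles and girth. -/

namespace SimpleGraph

variable {V : Type*} {G : SimpleGraph V}

theorem egirth_le_three_of_adj {a b c : V} (hab : G.Adj a b) (hbc : G.Adj b c)
    (hca : G.Adj c a) : G.egirth ≤ 3 := by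
  have hw : (Walk.cons hab (.cons hbc (.cons hca .nil))).IsCycle := by
    simp [Walk.cons_isCycle_iff, hab.ne, hab.ne', hbc.ne, hca.ne, hca.ne']
  simpa using hw.egirth_le_length

theorem egirth_le_four_of_adj {a b c d : V} (hab : G.Adj a b) (hbc : G.Adj b c)
    (hcd : G.Adj c d) (hda : G.Adj d a) (hac : a ≠ c) (hbd : b ≠ d) : G.egirth ≤ 4 := by
  have hw : (Walk.cons hab (.cons hbc (.cons hcd (.cons hda .nil)))).IsCycle := by
    simp [Walk.cons_isCycle_iff, hab.ne, hab.ne', hbc.ne, hcd.ne, hda.ne, hda.ne', hac.symm, hbd,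
      hac]
  simpa using hw.egirth_le_length

theorem Walk.IsCycle.exists_triangle {v : V} {w : G.Walk v v} (hw : w.IsCycle)
    (h3 : w.length ≤ 3) : ∃ a b c, G.Adj a b ∧ G.Adj b c ∧ G.Adj c a := by
  have hl := hw.three_le_length
  have h0 := w.adj_getVert_succ (i := 0) (by lia)
  have h1 := w.adj_getVert_succ (i := 1) (by lia)
  have h2 := w.adj_getVert_succ (i := 2) (by lia)
  rw [show 2 + 1 = w.length by lia, w.getVert_length] at h2
  rw [w.getVert_zero] at h0
  exact ⟨_, _, _, h0, h1, h2⟩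

theorem four_le_egirth_of_forall_not_adj
    (h : ∀ a b c, G.Adj a b → G.Adj b c → ¬ G.Adj c a) : 4 ≤ G.egirth := by
  rw [le_egirth]
  intro v w hw
  by_contra! hlt
  have hlt' : w.length < 4 := by exact_mod_cast hlt
  obtain ⟨a, b, c, hab, hbc, hca⟩ := hw.exists_triangle (by lia)
  exact h a b c hab hbc hca

theorem Walk.IsCycle.exists_adj_ne {v : V} {w : G.Walk v v} (hw : w.IsCycle) (a : V) :
    ∃ b c, G.Adj b c ∧ b ≠ a ∧ c ≠ a := by
  have hl := hw.three_le_length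
  have h0 := w.adj_getVert_succ (i := 0) (by lia)
  have h1 := w.adj_getVert_succ (i := 1) (by lia)
  have h2 := w.adj_getVert_succ (i := 2) (by lia)
  have h02 : w.getVert 0 ≠ w.getVert 2 := fun e => by
    have := hw.getVert_injOn' (by rw [Set.mem_ofPred_eq]; lia) (by rw [Set.mem_ofPred_eq]; lia) e
    lia
  -- In a triangle vertex 3 is the base point again, so injectivity is needed on the indices from 1
  -- up to the length.
  have h13 : w.getVert 1 ≠ w.getVert 3 := fun e => by
    have := hw.getVert_injOn (by rw [Set.mem_ofPred_eq]; lia) (by rw [Set.mem_ofPred_eq]; lia) e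
    lia
  by_cases ha0 : w.getVert 0 = a
  · exact ⟨_, _, h1, ha0 ▸ h0.ne', ha0 ▸ h02.symm⟩
  · by_cases ha1 : w.getVert 1 = a
    · exact ⟨_, _, h2, ha1 ▸ h1.ne', ha1 ▸ h13.symm⟩
    · exact ⟨_, _, h0, ha0, ha1⟩

end SimpleGraph

/-! ### Girth of nilpotent graphs. -/

section NilpotentGraph

open SimpleGraph

theorem IsNilpotent.of_isTwoPrimal_mul_left {S : Type*} [Ring S] (hS : IsTwoPrimal S) {a : S}
    (ha : IsNilpotent a) (b : S) : IsNilpotent (b * a) := by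
  have ha' : a ∈ (primeRadical S : Set S) := by rw [hS]; exact ha
  have hba : b * a ∈ (primeRadical S : Set S) := (primeRadical S).mul_mem_left b a ha'
  rw [hS] at hba
  exact hba

theorem mul_eq_zero_swap {S : Type*} [Ring S] [IsReduced S] {a b : S} (h : a * b = 0) :
    b * a = 0 :=
  (isNilpotent_mul_swap (h ▸ IsNilpotent.zero)).eq_zero

theorem nilpotentGraph_egirth_le_three_of_not_isReduced {S : Type*} [Ring S] (hS : IsTwoPrimal S)
    (hred : ¬ IsReduced S) {v : nilZeroDivisors S} {w : (nilpotentGraph S).Walk v v}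
    (hw : w.IsCycle) : (nilpotentGraph S).egirth ≤ 3 := by
  have : ∃ a : S, IsNilpotent a ∧ a ≠ 0 := by
    by_contra! h
    exact hred ⟨h⟩
  obtain ⟨a, ha, ha0⟩ := this
  have hmul := fun b => ha.of_isTwoPrimal_mul_left hS b
  let a' : nilZeroDivisors S := ⟨a, ha0, a, ha0, hmul a⟩
  obtain ⟨b, c, hbc, hba, hca⟩ := hw.exists_adj_ne a'
  exact egirth_le_three_of_adj (a := a') ⟨hba.symm, isNilpotent_mul_swap (hmul b)⟩ hbc
    ⟨hca, hmul c⟩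

theorem mem_nilZeroDivisors_of_mul_eq_zero {S : Type*} [Ring S] {a b : S} (ha : a ≠ 0) (hb : b ≠ 0)
    (hab : a * b = 0) : a ∈ nilZeroDivisors S :=
  ⟨ha, b, hb, hab ▸ IsNilpotent.zero⟩

section Reduced

variable {S : Type*} [Ring S] [IsReduced S]

theorem nilpotentGraph_adj_iff {a b : nilZeroDivisors S} :
    (nilpotentGraph S).Adj a b ↔ (a : S) * (b : S) = 0 := by
  refine ⟨fun h => h.2.eq_zero, fun h => ⟨?_, h ▸ IsNilpotent.zero⟩⟩
  rintro rfl
  exact a.2.1 (_root_.eq_zero_of_pow_eq_zero (n := 2) (by rw [sq]; exact h))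

theorem nilpotentGraph_egirth_le_three_of_mul_eq_zero {a b c : S} (ha : a ≠ 0) (hb : b ≠ 0)
    (hc : c ≠ 0) (hab : a * b = 0) (hbc : b * c = 0) (hca : c * a = 0) :
    (nilpotentGraph S).egirth ≤ 3 :=
  egirth_le_three_of_adj
    (a := ⟨a, mem_nilZeroDivisors_of_mul_eq_zero ha hb hab⟩)
    (b := ⟨b, mem_nilZeroDivisors_of_mul_eq_zero hb hc hbc⟩)
    (c := ⟨c, mem_nilZeroDivisors_of_mul_eq_zero hc ha hca⟩)
    (nilpotentGraph_adj_iff.mpr hab) (nilpotentGraph_adj_iff.mpr hbc)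
    (nilpotentGraph_adj_iff.mpr hca)

/-- On a path `p, a, b, c, d` of a longer cycle, either `a c = 0` closes a triangle, or `a c` is a
new vertex joined to both `b` and `d`. -/
theorem nilpotentGraph_egirth_le_four {v : nilZeroDivisors S} {w : (nilpotentGraph S).Walk v v}
    (hw : w.IsCycle) : (nilpotentGraph S).egirth ≤ 4 := by
  by_cases hl : w.length ≤ 4
  · exact hw.egirth_le_length.trans (by exact_mod_cast hl)
  have h01 := w.adj_getVert_succ (i := 0) (by lia)
  have h12 := w.adj_getVert_succ (i := 1) (by lia)
  have h23 := w.adj_getVert_succ (i := 2) (by lia)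
  have h34 := w.adj_getVert_succ (i := 3) (by lia)
  have hinj : ∀ i j, i ≤ 4 → j ≤ 4 → i ≠ j → w.getVert i ≠ w.getVert j := fun i j hi hj hij e =>
    hij (hw.getVert_injOn' (by rw [Set.mem_ofPred_eq]; lia) (by rw [Set.mem_ofPred_eq]; lia) e)
  have h02 := hinj 0 2 (by lia) (by lia) (by lia)
  have h13 := hinj 1 3 (by lia) (by lia) (by lia)
  have h24 := hinj 2 4 (by lia) (by lia) (by lia)
  have h03 := hinj 0 3 (by lia) (by lia) (by lia)
  simp only [zero_add, Nat.reduceAdd] at h01 h12 h23 h34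
  generalize w.getVert 0 = p at *
  generalize w.getVert 1 = a at *
  generalize w.getVert 2 = b at *
  generalize w.getVert 3 = c at *
  generalize w.getVert 4 = d at *
  have hpa := nilpotentGraph_adj_iff.mp h01
  have hab := nilpotentGraph_adj_iff.mp h12
  have hbc := nilpotentGraph_adj_iff.mp h23
  have hcd := nilpotentGraph_adj_iff.mp h34
  by_cases hac : (a : S) * c = 0
  · exact (egirth_le_three_of_adj h12 h23
      (nilpotentGraph_adj_iff.mpr (mul_eq_zero_swap hac))).trans (by norm_num)
  -- The product `a * c` annihilates `b`, `d` and `p`.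
  have hacd : (a * c : S) * d = 0 := by rw [mul_assoc, hcd, mul_zero]
  have hbac : (b : S) * (a * c) = 0 := by rw [← mul_assoc, mul_eq_zero_swap hab, zero_mul]
  let e : nilZeroDivisors S := ⟨a * c, mem_nilZeroDivisors_of_mul_eq_zero hac d.2.1 hacd⟩
  -- If `c = a c`, then `p c = p a c = 0` and the 4-cycle is `p, a, b, c`; otherwise it is `b, c, d,
  -- a c`.
  by_cases hec : c = e
  · have hpc : (p : S) * c = 0 := by
      rw [show (c : S) = a * c from congrArg Subtype.val hec, ← mul_assoc, hpa, zero_mul]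
    exact egirth_le_four_of_adj h01 h12 h23
      (nilpotentGraph_adj_iff.mpr (mul_eq_zero_swap hpc)) h02 h13
  · exact egirth_le_four_of_adj h23 h34 (nilpotentGraph_adj_iff.mpr (mul_eq_zero_swap hacd))
      (nilpotentGraph_adj_iff.mpr (mul_eq_zero_swap hbac)) h24 hec

end Reduced

theorem nilpotentGraph_isContained {S T : Type*} [Ring S] [Ring T] (f : S →+* T)
    (hf : Function.Injective f) : (nilpotentGraph S).IsContained (nilpotentGraph T) := by
  let F : nilZeroDivisors S → nilZeroDivisors T := fun a =>
    ⟨f a, (map_ne_zero_iff f hf).mpr a.2.1, by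
      obtain ⟨b, hb, hab⟩ := a.2.2
      exact ⟨f b, (map_ne_zero_iff f hf).mpr hb, by simpa using hab.map f⟩⟩
  have hF : Function.Injective F := fun a b h => Subtype.ext (hf (congrArg Subtype.val h))
  exact ⟨⟨⟨F, fun {a b} h => ⟨fun e => h.1 (hF e), by simpa [F] using h.2.map f⟩⟩, hF⟩⟩

end NilpotentGraph

/-! ### Multiplying standard monomials by a variable. -/

section StdMonomial

variable {A : Type*} [Ring A]

theorem mul_stdMonomial {n : ℕ} (x : Fin n → A) (i : Fin n) (α : Fin n → ℕ)
    (h : ∀ k < i, α k = 0) : x i * stdMonomial x α = stdMonomial x (α + Pi.single i 1) := by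
  unfold stdMonomial
  induction n with
  | zero => exact i.elim0
  | succ n ih =>
    rw [List.ofFn_succ, List.ofFn_succ, List.prod_cons, List.prod_cons]
    revert h
    refine Fin.cases (fun _ => ?_) (fun j h => ?_) i
    · have : (fun k : Fin n => x k.succ ^ (α + Pi.single 0 1 : Fin (n + 1) → ℕ) k.succ)
          = fun k => x k.succ ^ α k.succ := by
        funext k
        simp
      rw [this, ← mul_assoc, ← pow_succ']
      simp
    · have hk : (fun k : Fin n => x k.succ ^ (α + Pi.single j.succ 1 : Fin (n + 1) → ℕ) k.succ)
          = fun k => x k.succ ^ ((fun k => α k.succ) + Pi.single j 1 : Fin n → ℕ) k := by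
        funext k
        simp [Pi.single_apply]
      have h0 := h 0 (Fin.succ_pos j)
      rw [hk, ← ih (fun k => x k.succ) j (fun k => α k.succ)
        fun k hk => h k.succ (Fin.succ_lt_succ_iff.mpr hk)]
      simp [h0]

theorem exists_eq_add_single {n : ℕ} {α : Fin n → ℕ} (h : α ≠ 0) :
    ∃ (i : Fin n) (β : Fin n → ℕ), α = β + Pi.single i 1 ∧ (∀ k < i, β k = 0) ∧ α i ≠ 0 ∧ ∀ k < i, α k = 0 := by
  have hne : ({i | α i ≠ 0} : Finset (Fin n)).Nonempty := by
    obtain ⟨i, hi⟩ := Function.ne_iff.mp h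
    exact ⟨i, by simpa using hi⟩
  obtain ⟨i, hi, hmin⟩ := Finset.exists_min_image _ id hne
  have hi' : α i ≠ 0 := by simpa using hi
  have hlt : ∀ k < i, α k = 0 := fun k hk => by
    by_contra hk0
    exact absurd (hmin k (by simpa using hk0)) (not_le.mpr hk)
  refine ⟨i, α - Pi.single i 1, ?_, fun k hk => ?_, hi', hlt⟩
  · funext k
    by_cases hk : k = i
    · subst hk
      simp
      lia
    · simp [hk]
  · simp [hlt k hk]

theorem sum_add_single {n : ℕ} (α : Fin n → ℕ) (i : Fin n) :
    ∑ k, (α + Pi.single i 1 : Fin n → ℕ) k = ∑ k, α k + 1 := by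
  simp [Finset.sum_add_distrib]

end StdMonomial

/-! ### Filtration by total degree and reordering of variables. -/

namespace IsSkewPBWExtension

variable {A : Type*} [Ring A] {R : Subring A} {n : ℕ} {x : Fin n → A}

/-- The left `R`-submodule spanned by the standard monomials of total degree less than `m`. -/
def degreeLT (R : Subring A) (x : Fin n → A) (m : ℕ) : Submodule R A :=
  Submodule.span R (stdMonomial x '' {α | ∑ i, α i < m})

theorem degreeLT_mono {m k : ℕ} (h : m ≤ k) : degreeLT R x m ≤ degreeLT R x k :=
  Submodule.span_mono (Set.image_mono fun _ hα => lt_of_lt_of_le hα h)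

theorem stdMonomial_mem_degreeLT {m : ℕ} {α : Fin n → ℕ} (h : ∑ i, α i < m) :
    stdMonomial x α ∈ degreeLT R x m :=
  Submodule.subset_span ⟨α, h, rfl⟩

theorem coe_mul_mem_degreeLT {m : ℕ} (r : R) {y : A} (h : y ∈ degreeLT R x m) :
    (r : A) * y ∈ degreeLT R x m :=
  (degreeLT R x m).smul_mem r h

theorem basis_apply (h : IsSkewPBWExtension R x) (α : Fin n → ℕ) :
    h.basis α = stdMonomial x α := by
  simp [basis]

theorem repr_coe_mul (h : IsSkewPBWExtension R x) (r : R) (y : A) (α : Fin n → ℕ) :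
    h.basis.repr ((r : A) * y) α = r * h.basis.repr y α := by
  have : (r : A) * y = r • y := rfl
  rw [this, map_smul, Finsupp.smul_apply, smul_eq_mul]

theorem repr_stdMonomial (h : IsSkewPBWExtension R x) (α : Fin n → ℕ) :
    h.basis.repr (stdMonomial x α) = Finsupp.single α 1 := by
  rw [← h.basis_apply, Module.Basis.repr_self]

theorem repr_eq_zero_of_mem_degreeLT (h : IsSkewPBWExtension R x) {m : ℕ} {y : A}
    (hy : y ∈ degreeLT R x m) {α : Fin n → ℕ} (hα : m ≤ ∑ i, α i) : h.basis.repr y α = 0 := by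
  induction hy using Submodule.span_induction with
  | mem y hy =>
    obtain ⟨β, hβ, rfl⟩ := hy
    rw [h.repr_stdMonomial, Finsupp.single_apply, if_neg]
    rintro rfl
    exact absurd hβ (not_lt.mpr hα)
  | zero => simp
  | add y z _ _ hy hz => simp [hy, hz]
  | smul r y _ hy => simp [hy]

theorem gen_mul_mem_degreeLT_of_forall (h : IsSkewPBWExtension R x) (i : Fin n) {m : ℕ}
    (hm : ∀ β : Fin n → ℕ, ∑ k, β k < m → x i * stdMonomial x β ∈ degreeLT R x (m + 1))
    {y : A} (hy : y ∈ degreeLT R x m) : x i * y ∈ degreeLT R x (m + 1) := by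
  induction hy using Submodule.span_induction with
  | mem y hy =>
    obtain ⟨β, hβ, rfl⟩ := hy
    exact hm β hβ
  | zero => simp
  | add y z _ _ hy hz =>
    rw [mul_add]
    exact add_mem hy hz
  | smul r y hy' hy =>
    have : x i * r • y = (h.sigma i r : A) * (x i * y) + (h.delta i r : A) * y := by
      rw [Subring.smul_def, smul_eq_mul, ← mul_assoc, h.mul_eq, add_mul, mul_assoc]
    rw [this]
    exact add_mem (coe_mul_mem_degreeLT _ hy)
      (coe_mul_mem_degreeLT _ (degreeLT_mono m.le_succ hy'))

/-- Applying the commutation relation in both directions gives `(1 - e d) xⱼ xᵢ` of degree less than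
2, and `xⱼ xᵢ` is a basis element. -/
theorem exists_swap (h : IsSkewPBWExtension R x) {i j : Fin n} (hji : j < i) :
    ∃ d e : R, e * d = 1 ∧ ∃ (r₀ : R) (r : Fin n → R),
      x i * x j = (d : A) * x j * x i + ((r₀ : A) + ∑ k, (r k : A) * x k) := by
  have hlin : ∀ (r₀ : R) (r : Fin n → R),
      (r₀ : A) + ∑ k, (r k : A) * x k ∈ degreeLT R x 2 := fun r₀ r => by
    refine add_mem ?_ (sum_mem fun k _ => coe_mul_mem_degreeLT _ ?_)
    · rw [← mul_one (r₀ : A), ← stdMonomial_zero x]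
      exact coe_mul_mem_degreeLT _ (stdMonomial_mem_degreeLT (by simp))
    · rw [← stdMonomial_single x]
      exact stdMonomial_mem_degreeLT (by simp)
  obtain ⟨d, -, r₀, r, hd⟩ := h.exists_comm j i
  obtain ⟨e, -, s₀, s, he⟩ := h.exists_comm i j
  have hl := hlin r₀ r
  have hl' := hlin s₀ s
  refine ⟨d, e, ?_, r₀, r, by rw [← hd]; abel⟩
  rw [← hd] at hl
  rw [← he] at hl'
  have hmon : x j * x i = stdMonomial x (Pi.single i 1 + Pi.single j 1) := by
    rw [← mul_stdMonomial, stdMonomial_single]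
    intro k hk
    simp [(hk.trans hji).ne]
  have hmem : ((1 - e * d : R) : A) * stdMonomial x (Pi.single i 1 + Pi.single j 1)
      ∈ degreeLT R x 2 := by
    have := add_mem (coe_mul_mem_degreeLT e hl) hl'
    convert this using 1
    rw [← hmon]
    push_cast
    noncomm_ring
  have := h.repr_eq_zero_of_mem_degreeLT hmem (α := Pi.single i 1 + Pi.single j 1)
    (by simp [Finset.sum_add_distrib])
  rw [repr_coe_mul, repr_stdMonomial] at this
  simp only [Finsupp.single_eq_same, mul_one] at this
  exact (sub_eq_zero.mp this).symm

/-- Moving `xᵢ` past the first variable `xⱼ` with `j < i` leaves a shorter monomial. A left inverse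
of `u` is carried along so that `u` can later be cancelled. -/
theorem exists_gen_mul_stdMonomial (h : IsSkewPBWExtension R x) (i : Fin n) (β : Fin n → ℕ) :
    ∃ u v : R, v * u = 1 ∧ x i * stdMonomial x β - (u : A) * stdMonomial x (β + Pi.single i 1)
      ∈ degreeLT R x (∑ k, β k + 1) := by
  induction hm : ∑ k, β k using Nat.strong_induction_on generalizing i β with
  | _ m ih =>
  -- Elements of `degreeLT R x m'` involve only monomials of degree below `m`, which the induction
  -- hypothesis covers.
  have ih' : ∀ m' ≤ m, ∀ (i : Fin n) (y : A), y ∈ degreeLT R x m' →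
      x i * y ∈ degreeLT R x (m' + 1) := fun m' hm' i y hy => by
    refine h.gen_mul_mem_degreeLT_of_forall i (fun γ hγ => ?_) hy
    obtain ⟨u, v, -, huv⟩ := ih _ (hγ.trans_le hm') i γ rfl
    rw [← sub_add_cancel (x i * stdMonomial x γ) ((u : A) * stdMonomial x (γ + Pi.single i 1))]
    refine add_mem (degreeLT_mono (by lia) huv)
      (coe_mul_mem_degreeLT _ (stdMonomial_mem_degreeLT ?_))
    rw [sum_add_single]
    lia
  by_cases hi : ∀ k < i, β k = 0
  · exact ⟨1, 1, one_mul 1, by simp [mul_stdMonomial x i β hi]⟩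
  have hβ : β ≠ 0 := by
    rintro rfl
    exact hi fun _ _ => rfl
  obtain ⟨j, γ, rfl, hγ, -, hj⟩ := exists_eq_add_single hβ
  have hji : j < i := by
    by_contra hle
    exact hi fun k hk => hj k (hk.trans_le (not_lt.mp hle))
  rw [sum_add_single] at hm
  obtain ⟨u, v, hvu, hu⟩ := ih (∑ k, γ k) (by lia) i γ rfl
  obtain ⟨d, e, hed, r₀, r, hd⟩ := h.exists_swap hji
  rw [hm] at hu
  refine ⟨d * h.sigma j u, h.sigma j v * e, ?_, ?_⟩
  · rw [mul_assoc, ← mul_assoc e, hed, one_mul, ← map_mul, hvu, map_one]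
  have hji' : x j * stdMonomial x (γ + Pi.single i 1)
      = stdMonomial x (γ + Pi.single j 1 + Pi.single i 1) := by
    rw [mul_stdMonomial, add_right_comm]
    intro k hk
    simp [hγ k hk, (hk.trans hji).ne]
  set y := x i * stdMonomial x γ - (u : A) * stdMonomial x (γ + Pi.single i 1) with hy
  have key : x i * stdMonomial x (γ + Pi.single j 1)
      - ((d * h.sigma j u : R) : A) * stdMonomial x (γ + Pi.single j 1 + Pi.single i 1)
      = (d : A) * ((h.delta j u : A) * stdMonomial x (γ + Pi.single i 1) + x j * y)
        + ((r₀ : A) * stdMonomial x γ + ∑ k, (r k : A) * (x k * stdMonomial x γ)) := by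
    have h1 : x i * stdMonomial x γ = (u : A) * stdMonomial x (γ + Pi.single i 1) + y := by
      rw [hy]; abel
    rw [← mul_stdMonomial x j γ hγ, ← mul_assoc, hd, add_mul, mul_assoc, h1, add_mul,
      Finset.sum_mul, mul_add, ← mul_assoc (d * x j : A), mul_assoc (d : A) (x j) (u : A), h.mul_eq,
      ← hji']
    push_cast
    simp only [mul_assoc, mul_add, add_mul]
    abel
  rw [key]
  refine add_mem (coe_mul_mem_degreeLT _ (add_mem (coe_mul_mem_degreeLT _ ?_) (ih' m le_rfl _ _ hu)))
    (add_mem (coe_mul_mem_degreeLT _ ?_) (sum_mem fun k _ => coe_mul_mem_degreeLT _ ?_))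
  · refine stdMonomial_mem_degreeLT ?_
    rw [sum_add_single]
    lia
  · exact stdMonomial_mem_degreeLT (by lia)
  · exact ih' m le_rfl _ _ (stdMonomial_mem_degreeLT (by lia))

theorem gen_mul_mem_degreeLT (h : IsSkewPBWExtension R x) (i : Fin n) {m : ℕ} {y : A}
    (hy : y ∈ degreeLT R x m) : x i * y ∈ degreeLT R x (m + 1) := by
  refine h.gen_mul_mem_degreeLT_of_forall i (fun β hβ => ?_) hy
  obtain ⟨u, v, -, huv⟩ := h.exists_gen_mul_stdMonomial i β
  rw [← sub_add_cancel (x i * stdMonomial x β) ((u : A) * stdMonomial x (β + Pi.single i 1))]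
  refine add_mem (degreeLT_mono (by lia) huv)
    (coe_mul_mem_degreeLT _ (stdMonomial_mem_degreeLT ?_))
  rw [sum_add_single]
  lia

end IsSkewPBWExtension

/-! ### Compatibility and leading coefficients. -/

theorem mul_sigma_eq_zero_iff {S : Type*} [Ring S] {n : ℕ} {σ : Fin n → S →+* S}
    (hσ : IsSigmaCompatible σ) (i : Fin n) (a b : S) : a * σ i b = 0 ↔ a * b = 0 := by
  have key : iterComp (fun i => ⇑(σ i)) (Pi.single i 1) = σ i := by
    clear hσ
    unfold iterComp
    induction n with
    | zero => exact i.elim0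
    | succ n ih =>
      rw [List.ofFn_succ, List.foldr_cons]
      refine Fin.cases ?_ (fun j => ?_) i
      · have : (List.ofFn fun k : Fin n =>
            (⇑(σ k.succ))^[(Pi.single 0 1 : Fin (n + 1) → ℕ) k.succ]) = List.replicate n id := by
          simp [← List.ofFn_const]
        rw [this]
        have hid : ∀ m, (List.replicate m (id : S → S)).foldr (fun g k => g ∘ k) id = id := by
          intro m
          induction m with
          | zero => rfl
          | succ m ihm => rw [List.replicate_succ, List.foldr_cons, ihm]; rfl
        rw [hid]
        simp
      · have : (fun k : Fin n => (⇑(σ k.succ))^[(Pi.single j.succ 1 : Fin (n + 1) → ℕ) k.succ])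
            = fun k => (⇑(σ k.succ))^[(Pi.single j 1 : Fin n → ℕ) k] := by
          funext k
          simp [Pi.single_apply]
        rw [this, ih (σ := fun k => σ k.succ) j]
        simp
  simpa only [key] using hσ a b (Pi.single i 1)

namespace IsSkewPBWExtension

variable {A : Type*} [Ring A] {R : Subring A} {n : ℕ} {x : Fin n → A}

theorem exists_stdMonomial_mul (h : IsSkewPBWExtension R x) (hS : IsSigmaCompatible h.sigma)
    [IsReduced R] (α β : Fin n → ℕ) (r : R) :
    ∃ s : R, (∀ a, a * s = 0 → a * r = 0) ∧
      stdMonomial x α * ((r : A) * stdMonomial x β) - (s : A) * stdMonomial x (α + β)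
        ∈ degreeLT R x (∑ k, (α + β) k) := by
  induction hm : ∑ k, α k generalizing α with
  | zero =>
    have : α = 0 := by
      funext k
      simpa using (Finset.sum_eq_zero_iff.mp hm) k (Finset.mem_univ k)
    subst this
    exact ⟨r, fun _ => id, by simp [stdMonomial_zero]⟩
  | succ m ih =>
    have hα : α ≠ 0 := by
      rintro rfl
      simp at hm
    obtain ⟨i, γ, rfl, hγ, -, -⟩ := exists_eq_add_single hα
    rw [sum_add_single] at hm
    obtain ⟨s, hs, hmem⟩ := ih γ (by lia)
    obtain ⟨u, v, hvu, hu⟩ := h.exists_gen_mul_stdMonomial i (γ + β)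
    refine ⟨h.sigma i s * u, fun a ha => ?_, ?_⟩
    · refine hs a ((mul_sigma_eq_zero_iff hS i a s).mp ?_)
      rw [← mul_assoc] at ha
      -- Reducedness turns `a σᵢ(s) u = 0` into `u a σᵢ(s) = 0`, so a left inverse of `u` suffices.
      rw [← one_mul (a * _), ← hvu, mul_assoc, mul_eq_zero_swap ha, mul_zero]
    rw [add_right_comm, sum_add_single]
    have hmem' := h.gen_mul_mem_degreeLT i hmem
    have hδ : (h.delta i s : A) * stdMonomial x (γ + β) ∈ degreeLT R x (∑ k, (γ + β) k + 1) :=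
      coe_mul_mem_degreeLT _ (stdMonomial_mem_degreeLT (by lia))
    convert add_mem (add_mem hmem' hδ) (coe_mul_mem_degreeLT (h.sigma i s) hu) using 1
    rw [← mul_stdMonomial x i γ hγ, mul_sub, ← mul_assoc (x i) (s : A), h.mul_eq]
    push_cast
    simp only [mul_assoc, mul_sub, add_mul]
    abel

/-- The total degree of an exponent, refined by the lexicographic order. -/
def degLexKey (α : Fin n → ℕ) : ℕ ×ₗ Lex (Fin n → ℕ) :=
  toLex (∑ i, α i, toLex α)

theorem degLexKey_add (α β : Fin n → ℕ) :
    degLexKey (α + β) = degLexKey α + degLexKey β := by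
  simp only [degLexKey, Pi.add_apply, Finset.sum_add_distrib]
  rfl

theorem degLexKey_injective : Function.Injective (degLexKey (n := n)) := fun _ _ h =>
  congrArg (fun p : ℕ ×ₗ Lex (Fin n → ℕ) => ofLex (ofLex p).2) h

theorem sum_le_of_degLexKey_le {α β : Fin n → ℕ} (h : degLexKey α ≤ degLexKey β) :
    ∑ i, α i ≤ ∑ i, β i := by
  rcases Prod.Lex.le_iff.mp h with h | h
  · exact h.le
  · exact h.1.le

/-- `α` is the largest exponent occurring in `f`. -/
def IsLeadingExponent (h : IsSkewPBWExtension R x) (f : A) (α : Fin n → ℕ) : Prop :=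
  h.basis.repr f α ≠ 0 ∧ ∀ β, h.basis.repr f β ≠ 0 → degLexKey β ≤ degLexKey α

theorem exists_isLeadingExponent (h : IsSkewPBWExtension R x) {f : A} (hf : f ≠ 0) :
    ∃ α, h.IsLeadingExponent f α := by
  have hne : (h.basis.repr f).support.Nonempty := by
    rw [Finsupp.support_nonempty_iff]
    simpa using hf
  obtain ⟨α, hα, hmax⟩ := Finset.exists_max_image _ degLexKey hne
  exact ⟨α, Finsupp.mem_support_iff.mp hα, fun β hβ =>
    hmax β (Finsupp.mem_support_iff.mpr hβ)⟩

theorem sum_repr (h : IsSkewPBWExtension R x) (f : A) :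
    f = ∑ α ∈ (h.basis.repr f).support, (h.basis.repr f α : A) * stdMonomial x α := by
  conv_lhs => rw [← h.basis.linearCombination_repr f, Finsupp.linearCombination_apply]
  simp only [Finsupp.sum, basis_apply, Subring.smul_def, smul_eq_mul]

/-- The key is additive and injective, so only the two leading terms contribute to the coefficient
at `α + β`; the error terms have smaller total degree. -/
theorem IsLeadingExponent.mul_eq_zero {h : IsSkewPBWExtension R x}
    (hS : IsSigmaCompatible h.sigma) [IsReduced R] {f g : A} {α β : Fin n → ℕ}
    (hf : h.IsLeadingExponent f α) (hg : h.IsLeadingExponent g β) (hfg : f * g = 0) :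
    h.basis.repr f α * h.basis.repr g β = 0 := by
  choose s hs hmem using h.exists_stdMonomial_mul hS
  have hterm : ∀ α' β' (r : R), ∑ k, (α' + β') k ≤ ∑ k, (α + β) k →
      h.basis.repr (stdMonomial x α' * ((r : A) * stdMonomial x β')) (α + β) =
        (Finsupp.single (α' + β') (s α' β' r) : (Fin n → ℕ) →₀ R) (α + β) := by
    intro α' β' r hle
    have := h.repr_eq_zero_of_mem_degreeLT (hmem α' β' r) hle
    rw [map_sub, Finsupp.sub_apply, sub_eq_zero] at this
    rw [this, repr_coe_mul, repr_stdMonomial]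
    simp [Finsupp.single_apply]
  have hdeg : ∀ α' β', h.basis.repr f α' ≠ 0 → h.basis.repr g β' ≠ 0 →
      ∑ k, (α' + β') k ≤ ∑ k, (α + β) k := fun α' β' hα hβ => by
    simp only [Pi.add_apply, Finset.sum_add_distrib]
    exact add_le_add (sum_le_of_degLexKey_le (hf.2 _ hα)) (sum_le_of_degLexKey_le (hg.2 _ hβ))
  have huniq : ∀ α' β', h.basis.repr f α' ≠ 0 → h.basis.repr g β' ≠ 0 →
      α' + β' = α + β → α' = α ∧ β' = β := fun α' β' hα hβ e => by
    have e' := congrArg degLexKey e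
    rw [degLexKey_add, degLexKey_add] at e'
    obtain ⟨h1, h2⟩ := (add_eq_add_iff_eq_and_eq (hf.2 _ hα) (hg.2 _ hβ)).mp e'
    exact ⟨degLexKey_injective h1, degLexKey_injective h2⟩
  have hmul : f * g = ∑ α' ∈ (h.basis.repr f).support, ∑ β' ∈ (h.basis.repr g).support,
      (h.basis.repr f α' : A) *
        (stdMonomial x α' * ((h.basis.repr g β' : A) * stdMonomial x β')) := by
    conv_lhs => rw [h.sum_repr f, h.sum_repr g, Finset.sum_mul_sum]
    simp only [mul_assoc]
  have hcoeff : h.basis.repr (f * g) (α + β) =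
      h.basis.repr f α * s α β (h.basis.repr g β) := by
    rw [hmul]
    simp only [map_sum, Finsupp.finsetSum_apply, repr_coe_mul]
    rw [Finset.sum_eq_single_of_mem α (Finsupp.mem_support_iff.mpr hf.1),
      Finset.sum_eq_single_of_mem β (Finsupp.mem_support_iff.mpr hg.1), hterm _ _ _ le_rfl,
      Finsupp.single_eq_same]
    · intro β' hβ' hne
      have hβ'' := Finsupp.mem_support_iff.mp hβ'
      rw [hterm _ _ _ (hdeg _ _ hf.1 hβ''), Finsupp.single_apply,
        if_neg fun e => hne (huniq _ _ hf.1 hβ'' e).2, mul_zero]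
    · intro α' hα' hne
      have hα'' := Finsupp.mem_support_iff.mp hα'
      refine Finset.sum_eq_zero fun β' hβ' => ?_
      have hβ'' := Finsupp.mem_support_iff.mp hβ'
      rw [hterm _ _ _ (hdeg _ _ hα'' hβ''), Finsupp.single_apply,
        if_neg fun e => hne (huniq _ _ hα'' hβ'' e).1, mul_zero]
  refine hs α β _ _ ?_
  rw [← hcoeff, hfg, map_zero, Finsupp.zero_apply]

theorem isReduced (h : IsSkewPBWExtension R x) (hS : IsSigmaCompatible h.sigma) [IsReduced R] :
    IsReduced A := by
  rw [isReduced_iff_pow_one_lt 2 one_lt_two]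
  intro f hf
  by_contra hne
  obtain ⟨α, hα⟩ := h.exists_isLeadingExponent hne
  rw [sq] at hf
  have := hα.mul_eq_zero hS hα hf
  rw [← sq] at this
  exact hα.1 (eq_zero_of_pow_eq_zero this)

theorem four_le_nilpotentGraph_egirth (h : IsSkewPBWExtension R x)
    (hS : IsSigmaCompatible h.sigma) [IsReduced R] (hR : ¬ (nilpotentGraph R).egirth ≤ 3) :
    4 ≤ (nilpotentGraph A).egirth := by
  have := h.isReduced hS
  refine SimpleGraph.four_le_egirth_of_forall_not_adj fun a b c hab hbc hca => hR ?_
  obtain ⟨α, hα⟩ := h.exists_isLeadingExponent a.2.1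
  obtain ⟨β, hβ⟩ := h.exists_isLeadingExponent b.2.1
  obtain ⟨γ, hγ⟩ := h.exists_isLeadingExponent c.2.1
  exact nilpotentGraph_egirth_le_three_of_mul_eq_zero hα.1 hβ.1 hγ.1
    (hα.mul_eq_zero hS hβ (nilpotentGraph_adj_iff.mp hab))
    (hβ.mul_eq_zero hS hγ (nilpotentGraph_adj_iff.mp hbc))
    (hγ.mul_eq_zero hS hα (nilpotentGraph_adj_iff.mp hca))

end IsSkewPBWExtension

theorem mainTheorem4 {A : Type*} [Ring A] (R : Subring A) {n : ℕ} (x : Fin n → A)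
    (hA : IsSkewPBWExtension R x)
    (hS : IsSigmaCompatible hA.sigma) (hD : IsDeltaCompatible hA.delta)
    (hR : IsTwoPrimal R) :
    (nilpotentGraph A).egirth ≤ (nilpotentGraph R).egirth ∧
      ((∃ (v : nilZeroDivisors R) (w : (nilpotentGraph R).Walk v v), w.IsCycle) →
        (nilpotentGraph R).egirth = (nilpotentGraph A).egirth) := by
  have hle : (nilpotentGraph A).egirth ≤ (nilpotentGraph R).egirth :=
    (nilpotentGraph_isContained R.subtype R.subtype_injective).egirth_le
  refine ⟨hle, fun ⟨v, w, hw⟩ => le_antisymm ?_ hle⟩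
  by_cases h3 : (nilpotentGraph R).egirth ≤ 3
  · exact h3.trans SimpleGraph.three_le_egirth
  · have : IsReduced R := by
      by_contra hred
      exact h3 (nilpotentGraph_egirth_le_three_of_not_isReduced hR hred hw)
    exact (nilpotentGraph_egirth_le_four hw).trans (hA.four_le_nilpotentGraph_egirth hS h3)
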